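/- Let $\mu\in\mathbb R$ and $\sigma,\alpha,\beta>0$. Let $\mathrm{GL}(\mu,\sigma,\alpha,\beta)$ be the generalized logistic distribution (of type IV), i.e. the probability distribution on $\mathbb R$ with density $$x\mapsto \frac{1}{B(\alpha,\beta)}\,f(x)\,F(x)^{\alpha-1}\,(1-F(x))^{\beta-1},\qquad f(x)=\frac{e^{-(x-\mu)/\sigma}}{\sigma\,(1+e^{-(x-\mu)/\sigma})^2},\quad F(x)=\frac{1}{1+e^{-(x-\mu)/\sigma}},$$ where $B(\alpha,\beta)=\Gamma(\alpha)\Gamma(\beta)/\Gamma(\alpha+\beta)$. Then: (i) $\mathrm{GL}(\mu,\sigma,\alpha,\beta)$ is infinitely divisible: for every $n\ge 1$ it is the $n$-fold convolution of some probability measure with itself. (ii) Its Lévy triplet (with respect to the truncation function $x\mathbf 1_{|x|<1}$) is $(a,0,v(x)\,dx)$, where $$a=\sigma\int_0^{1/\sigma}\frac{e^{-\beta x}-e^{-\alpha x}}{1-e^{-x}}\,dx+\mu,\qquad v(x)=\frac{e^{-(\beta\mathbf 1_{x>0}+\alpha\mathbf 1_{x<0})|x|/\sigma}}{|x|\,(1-e^{-|x|/\sigma})};$$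 that is, $\int_{\mathbb R}\min(1,x^2)\,v(x)\,dx<\infty$ and the characteristic function $\varphi$ of $\mathrm{GL}(\mu,\sigma,\alpha,\beta)$ satisfies, for all $z\in\mathbb R$, $$\varphi(z)=\exp\Big(iza+\int_{\mathbb R}\big(e^{izx}-1-izx\mathbf 1_{|x|<1}\big)\,v(x)\,dx\Big).$$ (iii) $\mathrm{GL}(\mu,\sigma,\alpha,\beta)$ is self-decomposable: if $X$ has this distribution, then for every $c\in(0,1)$ there is a probability measure $\rho_c$ such that the distribution of $X$ is the convolution of the distribution of $cX$ with $\rho_c$. -/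

import Mathlib

open MeasureTheory

namespace GenLogistic

noncomputable section

/-- Probability density function of the location-scale logistic distribution. -/
def logisticPDF (μ σ x : ℝ) : ℝ :=
  Real.exp (-((x - μ) / σ)) / (σ * (1 + Real.exp (-((x - μ) / σ))) ^ 2)

/-- Cumulative distribution function of the location-scale logistic distribution. -/
def logisticCDF (μ σ x : ℝ) : ℝ :=
  1 / (1 + Real.exp (-((x - μ) / σ)))

/-- Density of the generalized logistic distribution of type IV,
`B(α, β)⁻¹ f(x) F(x) ^ (α - 1) (1 - F(x)) ^ (β - 1)`, where `f` and `F` are the density and the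
distribution function of the logistic distribution; `ProbabilityTheory.beta α β` is
`Γ(α) Γ(β) / Γ(α + β)`. -/
def glPDF (μ σ α β x : ℝ) : ℝ :=
  1 / ProbabilityTheory.beta α β * logisticPDF μ σ x * logisticCDF μ σ x ^ (α - 1)
    * (1 - logisticCDF μ σ x) ^ (β - 1)

/-- The generalized logistic distribution `GL(μ, σ, α, β)`, as a measure on `ℝ`. -/
def glMeasure (μ σ α β : ℝ) : Measure ℝ :=
  volume.withDensity fun x => ENNReal.ofReal (glPDF μ σ α β x)

/-- The `n`-fold convolution of a measure on `ℝ` with itself. -/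
def convPow (ρ : Measure ℝ) : ℕ → Measure ℝ
  | 0 => Measure.dirac 0
  | n + 1 => (convPow ρ n).conv ρ

/-- For every `n ≥ 1` the measure is the `n`-fold convolution of a probability measure with
itself. -/
def IsInfinitelyDivisible (P : Measure ℝ) : Prop :=
  ∀ n : ℕ, 1 ≤ n → ∃ ρ : Measure ℝ, IsProbabilityMeasure ρ ∧ P = convPow ρ n

/-- Lévy measures on `ℝ`. -/
structure IsLevyMeasure (ν : Measure ℝ) : Prop where
  zero : ν {0} = 0
  lintegral_lt_top : ∫⁻ x, ENNReal.ofReal (min 1 (x ^ 2)) ∂ν < ⊤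

/-- The exponent of the Lévy–Khintchine representation with drift `a`, Gaussian variance `b` and
Lévy measure `ν`, for the truncation function `x ↦ x 1_{|x| < 1}`. -/
def levyExponent (a b : ℝ) (ν : Measure ℝ) (z : ℝ) : ℂ :=
  Complex.I * z * a - 1 / 2 * (z : ℂ) ^ 2 * b
    + ∫ x : ℝ, (Complex.exp (Complex.I * z * x) - 1
        - Complex.I * z * x * (if |x| < 1 then 1 else 0)) ∂ν

/-- `(a, b, ν)` is the Lévy triplet of the probability measure `P`. -/
structure HasLevyTriplet (P : Measure ℝ) (a b : ℝ) (ν : Measure ℝ) : Prop where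
  isProbabilityMeasure : IsProbabilityMeasure P
  gaussian_nonneg : 0 ≤ b
  isLevyMeasure : IsLevyMeasure ν
  charFun_eq : ∀ z : ℝ, charFun P z = Complex.exp (levyExponent a b ν z)

/-- `P` is the law of some `X` such that, for every `0 < c < 1`, `X` has the same law as `c X + Y`
with `Y` independent of `X`. -/
structure IsSelfDecomposable (P : Measure ℝ) : Prop where
  isProbabilityMeasure : IsProbabilityMeasure P
  exists_conv : ∀ c : ℝ, 0 < c → c < 1 →
    ∃ ρ : Measure ℝ, IsProbabilityMeasure ρ ∧ P = (P.map fun x => c * x).conv ρ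

/-- The drift in the Lévy triplet of `GL(μ, σ, α, β)`. -/
def glDrift (μ σ α β : ℝ) : ℝ :=
  σ * (∫ x in (0 : ℝ)..σ⁻¹,
    (Real.exp (-(β * x)) - Real.exp (-(α * x))) / (1 - Real.exp (-x))) + μ

/-- The density of the Lévy measure of `GL(μ, σ, α, β)`. -/
def glLevyDensity (σ α β x : ℝ) : ℝ :=
  Real.exp (-(((if 0 < x then β else 0) + (if x < 0 then α else 0)) * (|x| / σ)))
    / (|x| * (1 - Real.exp (-|x| / σ)))

/-- The Lévy measure `v(x) dx` of `GL(μ, σ, α, β)`. -/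
def glLevyMeasure (σ α β : ℝ) : Measure ℝ :=
  volume.withDensity fun x => ENNReal.ofReal (glLevyDensity σ α β x)

end

end GenLogistic

namespace GenLogistic

open ProbabilityTheory Filter Topology

/-! The substitution u = F(x) turns the characteristic function into a beta integral, so φ(z) =
exp(izμ) Γ(α + izσ) Γ(β - izσ) / (Γ(α) Γ(β)). Euler's limit for Γ factors this as the product over j
≥ 0 of (β + j)/(β + j - izσ) · (α + j)/(α + j + izσ): the law is that of μ plus a series of
independent differences of exponential variables with rates (β + j)/σ and (α + j)/σ.

All three claims reduce to one exponential variable of rate r. It is infinitely divisible (gamma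
laws of shape 1/n) and self-decomposable (`isCharExponent_exponential_sub`), and its Lévy measure is
exp(-rx)/x dx (`integral_frullani`). Summing these Lévy densities over j is a geometric series with
sum v; the truncation terms of the two families combine into the drift.

Working with exponents instead of φ makes n-th roots and quotients φ(z)/φ(cz) linear operations. The
limit N → ∞ is Lévy's continuity theorem, `isCharExponent_of_tendsto`. -/

/-! ### Exponents of characteristic functions and Lévy's continuity theorem -/

/-- `exp ∘ G` is the characteristic function of a probability measure. -/
def IsCharExponent (G : ℝ → ℂ) : Prop :=
  ∃ ρ : Measure ℝ, IsProbabilityMeasure ρ ∧ ∀ z, charFun ρ z = Complex.exp (G z)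

lemma IsCharExponent.congr {G H : ℝ → ℂ} (hG : IsCharExponent G)
    (h : ∀ z, Complex.exp (H z) = Complex.exp (G z)) : IsCharExponent H := by
  obtain ⟨ρ, hρ, e⟩ := hG
  exact ⟨ρ, hρ, fun z => (e z).trans (h z).symm⟩

lemma IsCharExponent.add {G H : ℝ → ℂ} (hG : IsCharExponent G) (hH : IsCharExponent H) :
    IsCharExponent fun z => G z + H z := by
  obtain ⟨ρ, hρ, e⟩ := hG
  obtain ⟨τ, hτ, e'⟩ := hH
  exact ⟨ρ.conv τ, inferInstance, fun z => by rw [charFun_conv, e, e', Complex.exp_add]⟩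

lemma IsCharExponent.comp_mul {G : ℝ → ℂ} (hG : IsCharExponent G) (c : ℝ) :
    IsCharExponent fun z => G (c * z) := by
  obtain ⟨ρ, hρ, e⟩ := hG
  refine ⟨ρ.map fun x => c * x, Measure.isProbabilityMeasure_map (by fun_prop), fun z => ?_⟩
  rw [charFun_map_mul, e]

lemma isCharExponent_linear (m : ℝ) : IsCharExponent fun z => Complex.I * z * m :=
  ⟨Measure.dirac m, inferInstance, fun z => by
    rw [charFun_dirac]
    congr 1
    simp only [RCLike.inner_apply, conj_trivial, Complex.ofReal_mul]
    ring⟩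

lemma isCharExponent_sum {G : ℕ → ℝ → ℂ} (hG : ∀ j, IsCharExponent (G j)) (N : ℕ) :
    IsCharExponent fun z => ∑ j ∈ Finset.range N, G j z := by
  induction N with
  | zero =>
    refine (isCharExponent_linear 0).congr fun z => ?_
    simp
  | succ N ih => simpa only [Finset.sum_range_succ] using ih.add (hG N)

/-- A pointwise limit of exponents of characteristic functions that is continuous at `0` is again
such an exponent. -/
lemma isCharExponent_of_tendsto {G : ℕ → ℝ → ℂ} {H : ℝ → ℂ} (hG : ∀ N, IsCharExponent (G N))
    (hlim : ∀ z, Tendsto (fun N => G N z) atTop (𝓝 (H z))) (hH : ContinuousAt H 0) :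
    IsCharExponent H := by
  choose ρ hρ e using hG
  have hl : ∀ z, Tendsto (fun N => charFun (ρ N) z) atTop (𝓝 (Complex.exp (H z))) := fun z => by
    simp_rw [e]
    exact (Complex.continuous_exp.tendsto _).comp (hlim z)
  have ht : IsTightMeasureSet (Set.range ρ) :=
    isTightMeasureSet_of_tendsto_charFun (Complex.continuous_exp.continuousAt.comp hH) hl
  let P : ℕ → ProbabilityMeasure ℝ := fun N => ⟨ρ N, hρ N⟩
  have hc : IsCompact (closure (Set.range P)) := by
    refine isCompact_closure_of_isTightMeasureSet (ht.subset ?_)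
    rintro _ ⟨_, ⟨N, rfl⟩, rfl⟩
    exact ⟨N, rfl⟩
  -- By compactness the sequence converges along an ultrafilter finer than `atTop`; this suffices to
  -- identify the characteristic function of the limit, with no subsequence to extract.
  obtain ⟨P₀, -, hP⟩ := hc.ultrafilter_le_nhds ((Ultrafilter.of (atTop : Filter ℕ)).map P)
    (le_principal_iff.2 (mem_of_superset (by simp) subset_closure))
  refine ⟨P₀, inferInstance, fun z => ?_⟩
  have h1 : Tendsto (fun N => charFun (P N : Measure ℝ) z) (↑(Ultrafilter.of (atTop : Filter ℕ)))
      (𝓝 (charFun (P₀ : Measure ℝ) z)) := by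
    have h : Tendsto P (↑(Ultrafilter.of (atTop : Filter ℕ))) (𝓝 P₀) := hP
    rw [ProbabilityMeasure.tendsto_iff_forall_integral_rclike_tendsto ℂ] at h
    simp_rw [charFun_eq_integral_innerProbChar]
    exact h (BoundedContinuousFunction.innerProbChar z)
  exact tendsto_nhds_unique h1 ((hl z).mono_left (Ultrafilter.of_le atTop))

/-! ### Gamma and exponential distributions -/

lemma one_sub_div_mem_slitPlane {z : ℂ} {r : ℝ} (hr : 0 < r) (hz : z.re < r) :
    1 - z / r ∈ Complex.slitPlane := by
  refine Or.inl ?_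
  rw [Complex.sub_re, Complex.div_ofReal_re, Complex.one_re, sub_pos, div_lt_one hr]
  exact hz

lemma mgf_gammaMeasure {a r t : ℝ} (ha : 0 < a) (hr : 0 < r) (ht : t < r) :
    mgf id (gammaMeasure a r) t = (1 - t / r) ^ (-a) := by
  have hm : Measurable (gammaPDF a r) := (measurable_gammaPDFReal a r).ennreal_ofReal
  rw [mgf, gammaMeasure, integral_withDensity_eq_integral_toReal_smul hm
    (ae_of_all _ fun _ => ENNReal.ofReal_lt_top)]
  have h1 : ∀ x, (gammaPDF a r x).toReal • Real.exp (t * id x)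
      = (Set.Ici (0 : ℝ)).indicator
        (fun x => r ^ a / Real.Gamma a * (x ^ (a - 1) * Real.exp (-((r - t) * x)))) x := by
    intro x
    rw [gammaPDF, ENNReal.toReal_ofReal (gammaPDFReal_nonneg ha hr x), gammaPDFReal]
    by_cases hx : 0 ≤ x
    · rw [if_pos hx, Set.indicator_of_mem (show x ∈ Set.Ici 0 from hx), smul_eq_mul, id,
        mul_assoc, mul_assoc, ← Real.exp_add]
      ring_nf
    · rw [if_neg hx, Set.indicator_of_notMem (show x ∉ Set.Ici 0 from hx), zero_smul]
  simp_rw [h1]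
  rw [integral_indicator measurableSet_Ici, integral_Ici_eq_integral_Ioi, integral_const_mul,
    Real.integral_rpow_mul_exp_neg_mul_Ioi ha (sub_pos.2 ht), one_div,
    Real.inv_rpow (sub_pos.2 ht).le, ← Real.rpow_neg (sub_pos.2 ht).le]
  have : 1 - t / r = (r - t) / r := by field_simp
  rw [this, Real.div_rpow (sub_pos.2 ht).le hr.le, Real.rpow_neg hr.le]
  have := (Real.Gamma_pos_of_pos ha).ne'
  have := (Real.rpow_pos_of_pos hr a).ne'
  field_simp

/-- Analytic continuation: the complex moment generating function and the claimed formula are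
analytic on Re z < r and agree at real points near 0, hence also at z = it. -/
lemma charFun_gammaMeasure {a r : ℝ} (ha : 0 < a) (hr : 0 < r) (t : ℝ) :
    charFun (gammaMeasure a r) t
      = Complex.exp (-(a * Complex.log (1 - Complex.I * t / r))) := by
  have hi : Set.Iio r ⊆ integrableExpSet id (gammaMeasure a r) := fun s hs => by
    -- A non-integrable function has integral 0 by convention, so the nonzero value already computed
    -- gives integrability.
    refine Integrable.of_integral_ne_zero ?_
    have := mgf_gammaMeasure ha hr hs
    rw [mgf] at this
    rw [this]
    refine (Real.rpow_pos_of_pos ?_ _).ne'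
    rw [sub_pos, div_lt_one hr]
    exact hs
  have hU : Convex ℝ {z : ℂ | z.re < r} := convex_halfSpace_re_lt r
  have hO : IsOpen {z : ℂ | z.re < r} := isOpen_lt Complex.continuous_re continuous_const
  have hf : AnalyticOnNhd ℂ (complexMGF id (gammaMeasure a r)) {z : ℂ | z.re < r} :=
    analyticOnNhd_complexMGF.mono fun z hz => interior_maximal hi isOpen_Iio hz
  have hg : AnalyticOnNhd ℂ (fun z => Complex.exp (-(a * Complex.log (1 - z / r))))
      {z : ℂ | z.re < r} := by
    refine DifferentiableOn.analyticOnNhd (fun z hz => ?_) hO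
    have := one_sub_div_mem_slitPlane hr hz
    have hd : DifferentiableAt ℂ (fun z : ℂ => 1 - z / r) z := by fun_prop
    exact (((hd.clog this).const_mul (a : ℂ)).neg.cexp).differentiableWithinAt
  have h0 : (0 : ℂ) ∈ {z : ℂ | z.re < r} := by simpa using hr
  have hfr : ∃ᶠ z in 𝓝[≠] (0 : ℂ), complexMGF id (gammaMeasure a r) z
      = Complex.exp (-(a * Complex.log (1 - z / r))) := by
    have ht : Tendsto (fun x : ℝ => (x : ℂ)) (𝓝[≠] 0) (𝓝[≠] 0) := by
      refine tendsto_nhdsWithin_of_tendsto_nhds_of_eventually_within _ ?_ ?_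
      · exact (Complex.continuous_ofReal.tendsto' 0 0 (by simp)).mono_left nhdsWithin_le_nhds
      · filter_upwards [self_mem_nhdsWithin] with x hx
        simpa using hx
    refine ht.frequently (Eventually.frequently ?_)
    filter_upwards [nhdsWithin_le_nhds (Iio_mem_nhds hr)] with x hx
    have hp : 0 < 1 - x / r := by
      rw [sub_pos, div_lt_one hr]
      exact hx
    rw [complexMGF_ofReal, mgf_gammaMeasure ha hr hx, Real.rpow_def_of_pos hp, Complex.ofReal_exp,
      Complex.ofReal_mul, Complex.ofReal_log hp.le]
    push_cast
    congr 1
    ring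
  have key := hf.eqOn_of_preconnected_of_frequently_eq hg hU.isPreconnected h0 hfr
  have := key (show (t * Complex.I : ℂ) ∈ {z : ℂ | z.re < r} by simpa using hr)
  rw [complexMGF_id_mul_I] at this
  rw [this, mul_comm Complex.I]

lemma isCharExponent_gamma {a r : ℝ} (ha : 0 < a) (hr : 0 < r) :
    IsCharExponent fun z => -(a * Complex.log (1 - Complex.I * z / r)) :=
  ⟨_, isProbabilityMeasure_gammaMeasure ha hr, charFun_gammaMeasure ha hr⟩

/-- The exponential distribution is self-decomposable. -/
lemma isCharExponent_exponential_sub {r c : ℝ} (hr : 0 < r) (hc : 0 < c) (hc' : c < 1) :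
    IsCharExponent fun z => -Complex.log (1 - Complex.I * z / r)
      + Complex.log (1 - Complex.I * (c * z : ℝ) / r) := by
  have := isProbabilityMeasure_gammaMeasure one_pos hr
  -- The mixture is read off from (1 - icz/r)/(1 - iz/r) = c + (1 - c)/(1 - iz/r).
  refine ⟨ENNReal.ofReal c • Measure.dirac 0 + ENNReal.ofReal (1 - c) • gammaMeasure 1 r,
    ⟨?_⟩, fun z => ?_⟩
  · simp only [Measure.coe_add, Measure.coe_smul, Pi.add_apply, Pi.smul_apply, measure_univ,
      smul_eq_mul, mul_one]
    rw [← ENNReal.ofReal_add hc.le (sub_pos.2 hc').le]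
    simp
  · have h1 : ∀ z : ℝ, (1 - Complex.I * z / r : ℂ) ≠ 0 := fun z =>
      Complex.slitPlane_ne_zero (one_sub_div_mem_slitPlane hr (by simpa using hr))
    have hi : ∀ (ρ : Measure ℝ) [IsProbabilityMeasure ρ],
        Integrable (fun x : ℝ => Complex.exp (z * x * Complex.I)) ρ := fun ρ _ => by
      refine Integrable.mono' (integrable_const (1 : ℝ)) (by fun_prop) (ae_of_all _ fun x => ?_)
      rw [← Complex.ofReal_mul, Complex.norm_exp_ofReal_mul_I]
    rw [charFun_apply_real, integral_add_measure ((hi _).smul_measure ENNReal.ofReal_ne_top)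
      ((hi _).smul_measure ENNReal.ofReal_ne_top), integral_smul_measure, integral_smul_measure,
      ← charFun_apply_real, ← charFun_apply_real, charFun_gammaMeasure one_pos hr,
      Complex.ofReal_one, one_mul, Complex.exp_add, Complex.exp_neg, Complex.exp_log (h1 z),
      Complex.exp_log (h1 _), ENNReal.toReal_ofReal hc.le, ENNReal.toReal_ofReal (sub_pos.2 hc').le,
      charFun_dirac]
    have := h1 z
    have hr' : (r : ℂ) ≠ 0 := by exact_mod_cast hr.ne'
    simp only [inner_zero_left, Complex.ofReal_zero, zero_mul, Complex.exp_zero,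
      Complex.real_smul]
    rw [eq_inv_mul_iff_mul_eq₀ this, mul_add, mul_one, mul_left_comm, mul_inv_cancel₀ this]
    push_cast
    ring

/-! ### The Frullani integral -/

lemma norm_exp_I_mul_sub_one_le (z x : ℝ) :
    ‖Complex.exp (Complex.I * z * x) - 1‖ ≤ |z| * |x| := by
  have := Real.norm_exp_I_mul_ofReal_sub_one_le (x := z * x)
  rwa [Complex.ofReal_mul, ← mul_assoc, Real.norm_eq_abs, abs_mul] at this

lemma integrableOn_exp_neg_mul {r : ℝ} (hr : 0 < r) :
    IntegrableOn (fun x => Real.exp (-(r * x))) (Set.Ioi 0) := by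
  simpa only [neg_mul] using integrableOn_exp_mul_Ioi (neg_neg_of_pos hr) 0

lemma integrableOn_frullani {r : ℝ} (hr : 0 < r) (z : ℝ) :
    IntegrableOn (fun x : ℝ => (Complex.exp (Complex.I * z * x) - 1)
      * (Real.exp (-(r * x)) / x : ℝ)) (Set.Ioi 0) := by
  refine Integrable.mono' ((integrableOn_exp_neg_mul hr).const_mul |z|)
    (Measurable.aestronglyMeasurable (by fun_prop)) ?_
  refine (ae_restrict_iff' measurableSet_Ioi).2 (ae_of_all _ fun x hx => ?_)
  have hx : 0 < x := hx
  rw [norm_mul, Complex.norm_real, Real.norm_of_nonneg (by positivity)]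
  calc _ ≤ |z| * |x| * (Real.exp (-(r * x)) / x) := by
        gcongr
        exact norm_exp_I_mul_sub_one_le z x
    _ = _ := by rw [abs_of_pos hx]; field_simp

/-- The Lévy–Khintchine representation of the exponential distribution. -/
lemma integral_frullani {r : ℝ} (hr : 0 < r) (z : ℝ) :
    ∫ x in Set.Ioi (0 : ℝ), (Complex.exp (Complex.I * z * x) - 1)
      * (Real.exp (-(r * x)) / x : ℝ) = -Complex.log (1 - Complex.I * z / r) := by
  have hr' : (r : ℂ) ≠ 0 := by exact_mod_cast hr.ne'
  have hs : ∀ z : ℝ, (1 - Complex.I * z / r : ℂ) ∈ Complex.slitPlane := fun z =>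
    one_sub_div_mem_slitPlane hr (by simpa using hr)
  -- Differentiating in z removes the factor 1/x and leaves an elementary exponential integral.
  have h1 : ∀ z : ℝ, HasDerivAt (fun z : ℝ => ∫ x in Set.Ioi (0 : ℝ),
      (Complex.exp (Complex.I * z * x) - 1) * (Real.exp (-(r * x)) / x : ℝ))
      (∫ x in Set.Ioi (0 : ℝ), Complex.I * Complex.exp ((Complex.I * z - r) * x)) z := by
    intro z
    refine (hasDerivAt_integral_of_dominated_loc_of_deriv_le (s := Set.univ)
      (F' := fun z x : ℝ => Complex.I * Complex.exp ((Complex.I * z - r) * x))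
      (bound := fun x => Real.exp (-(r * x))) univ_mem
      (Eventually.of_forall fun z => (integrableOn_frullani hr z).aestronglyMeasurable)
      (integrableOn_frullani hr z) (by fun_prop) (ae_of_all _ fun x z _ => ?_)
      (integrableOn_exp_neg_mul hr) ?_).2
    · rw [norm_mul, Complex.norm_I, one_mul, Complex.norm_exp]
      simp
    · refine (ae_restrict_iff' measurableSet_Ioi).2 (ae_of_all _ fun x hx z _ => ?_)
      have hx : (x : ℂ) ≠ 0 := by exact_mod_cast (show (0 : ℝ) < x from hx).ne'
      have hd : HasDerivAt (fun z : ℝ => (Complex.I * z * x : ℂ)) (Complex.I * 1 * x) z :=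
        ((Complex.ofRealCLM.hasDerivAt (x := z)).const_mul Complex.I).mul_const (x : ℂ)
      refine ((hd.cexp.sub_const 1).mul_const ((Real.exp (-(r * x)) / x : ℝ) : ℂ)).congr_deriv ?_
      have : (Complex.I * z - r) * x = Complex.I * z * x + -(r * x) := by ring
      rw [this, Complex.exp_add]
      push_cast
      field_simp
  have h2 : ∀ z : ℝ, HasDerivAt (fun z : ℝ => -Complex.log (1 - Complex.I * z / r))
      (-(-(Complex.I * 1 / r) / (1 - Complex.I * z / r))) z := fun z =>
    ((((Complex.ofRealCLM.hasDerivAt (x := z)).const_mul Complex.I).div_const (r : ℂ)).const_sub 1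
      |>.clog_real (hs z)).neg
  have h3 : ∀ z : ℝ, (∫ x in Set.Ioi (0 : ℝ), Complex.I * Complex.exp ((Complex.I * z - r) * x))
      = -(-(Complex.I * 1 / r) / (1 - Complex.I * z / r)) := by
    intro z
    have hn : Complex.I * z - r ≠ 0 := fun h => by
      have := congrArg Complex.re h
      simp at this
      exact hr.ne' this
    rw [integral_const_mul, integral_exp_mul_complex_Ioi (by simpa using hr)]
    have := Complex.slitPlane_ne_zero (hs z)
    simp only [Complex.ofReal_zero, mul_zero, Complex.exp_zero]
    have h4 : 1 - Complex.I * z / r = -(Complex.I * z - r) / r := by field_simp; ring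
    rw [h4]
    field_simp
  -- Both sides have the same derivative and vanish at z = 0.
  have h4 := is_const_of_deriv_eq_zero
    (f := fun z : ℝ => (∫ x in Set.Ioi (0 : ℝ),
      (Complex.exp (Complex.I * z * x) - 1) * (Real.exp (-(r * x)) / x : ℝ))
      - -Complex.log (1 - Complex.I * z / r))
    (fun z => ((h1 z).sub (h2 z)).differentiableAt)
    (fun z => by
      have := ((h1 z).sub (h2 z)).deriv
      rw [h3, sub_self] at this
      exact this) z 0
  simpa [sub_eq_zero, add_eq_zero_iff_eq_neg] using h4

/-! ### The Lévy–Khintchine kernel -/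

/-- The integrand of the Lévy–Khintchine formula. -/
noncomputable def levyKernel (z x : ℝ) : ℂ :=
  Complex.exp (Complex.I * z * x) - 1 - Complex.I * z * x * (if |x| < 1 then 1 else 0)

lemma measurable_levyKernel (z : ℝ) : Measurable (levyKernel z) := by
  have h : MeasurableSet {x : ℝ | |x| < 1} := measurableSet_lt (by fun_prop) (by fun_prop)
  have : Measurable fun x : ℝ => (if |x| < 1 then 1 else 0 : ℂ) :=
    Measurable.ite h measurable_const measurable_const
  unfold levyKernel
  fun_prop

lemma continuous_levyKernel (x : ℝ) : Continuous fun z => levyKernel z x := by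
  unfold levyKernel
  fun_prop

lemma levyKernel_neg (z x : ℝ) : levyKernel z (-x) = levyKernel (-z) x := by
  simp [levyKernel]

/-- For |x| < 1, Taylor's bound gives (zx)² if |zx| ≤ 1, and otherwise 2 + |zx| ≤ 3(zx)². For |x| ≥
1 the kernel is at most 2 ≤ 2x². The growth at infinity is harmless because v decays exponentially.
-/
lemma norm_levyKernel_le (z x : ℝ) : ‖levyKernel z x‖ ≤ (3 * z ^ 2 + 2) * x ^ 2 := by
  have h2 : ‖Complex.exp (Complex.I * z * x)‖ = 1 := by
    rw [mul_assoc, mul_comm, ← Complex.ofReal_mul, Complex.norm_exp_ofReal_mul_I]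
  have h3 : ‖Complex.exp (Complex.I * z * x) - 1‖ ≤ 2 := by
    refine (norm_sub_le _ _).trans ?_
    rw [h2, norm_one]
    norm_num
  have h4 : ‖Complex.I * z * x‖ = |z * x| := by simp
  unfold levyKernel
  split_ifs with h
  · rw [mul_one]
    by_cases h1 : |z * x| ≤ 1
    · have := Complex.norm_exp_sub_one_sub_id_le (x := Complex.I * z * x) (by rwa [h4])
      rw [h4, sq_abs] at this
      nlinarith [sq_nonneg (z * x), sq_nonneg x]
    · have h5 := norm_sub_le (Complex.exp (Complex.I * z * x) - 1) (Complex.I * z * x)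
      rw [h4] at h5
      have h6 : (z * x) ^ 2 = |z * x| ^ 2 := (sq_abs _).symm
      nlinarith [sq_nonneg x]
  · have h5 : 1 ≤ x ^ 2 := by rw [← sq_abs]; nlinarith
    rw [mul_zero, sub_zero]
    nlinarith [mul_nonneg (sq_nonneg z) (sq_nonneg x)]

/-- Against exp(-rx)/x the truncation term loses its factor x and becomes integrable by itself, so
it splits off from the Frullani integral. -/
lemma integrableOn_levyKernel_mul {r : ℝ} (hr : 0 < r) (z : ℝ) :
    IntegrableOn (fun x => levyKernel z x * (Real.exp (-(r * x)) / x : ℝ)) (Set.Ioi 0) ∧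
    ∫ x in Set.Ioi 0, levyKernel z x * (Real.exp (-(r * x)) / x : ℝ)
      = -Complex.log (1 - Complex.I * z / r)
        - Complex.I * z * (∫ x in (0 : ℝ)..1, Real.exp (-(r * x)) : ℝ) := by
  have h : ∀ x ∈ Set.Ioi (0 : ℝ), levyKernel z x * (Real.exp (-(r * x)) / x : ℝ)
      = (Complex.exp (Complex.I * z * x) - 1) * (Real.exp (-(r * x)) / x : ℝ)
      - Complex.I * z * (Set.Iio (1 : ℝ)).indicator (fun x => (Real.exp (-(r * x)) : ℂ)) x := by
    intro x hx
    have hx : 0 < x := hx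
    have hx' : (x : ℂ) ≠ 0 := by exact_mod_cast hx.ne'
    rw [levyKernel, abs_of_pos hx]
    by_cases h : x < 1
    · rw [if_pos h, Set.indicator_of_mem (show x ∈ Set.Iio 1 from h)]
      push_cast
      field_simp
    · rw [if_neg h, Set.indicator_of_notMem (show x ∉ Set.Iio 1 from h)]
      simp
  have hi : IntegrableOn (fun x => Complex.I * z *
      (Set.Iio (1 : ℝ)).indicator (fun x => (Real.exp (-(r * x)) : ℂ)) x) (Set.Ioi 0) :=
    ((Integrable.ofReal (integrableOn_exp_neg_mul hr)).indicator measurableSet_Iio).const_mul _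
  refine ⟨((integrableOn_frullani hr z).sub hi).congr_fun (fun x hx => (h x hx).symm)
    measurableSet_Ioi, ?_⟩
  rw [setIntegral_congr_fun measurableSet_Ioi h, integral_sub (integrableOn_frullani hr z) hi,
    integral_frullani hr, integral_const_mul, setIntegral_indicator measurableSet_Iio,
    Set.Ioi_inter_Iio, integral_complex_ofReal, intervalIntegral.integral_of_le zero_le_one,
    integral_Ioc_eq_integral_Ioo]

/-! ### The Lévy density and its integrability -/

lemma integral_eq_integral_Ioi_add_integral_Ioi_neg {E : Type*} [NormedAddCommGroup E]
    [NormedSpace ℝ E] {f : ℝ → E} (hf : IntegrableOn f (Set.Ioi 0))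
    (hf' : IntegrableOn (fun x => f (-x)) (Set.Ioi 0)) :
    Integrable f ∧ ∫ x, f x = (∫ x in Set.Ioi 0, f x) + ∫ x in Set.Ioi 0, f (-x) := by
  have h : IntegrableOn f (Set.Iic 0) := by
    rw [integrableOn_Iic_iff_integrableOn_Iio]
    simpa using hf'.comp_neg
  refine ⟨?_, ?_⟩
  · rw [← integrableOn_univ, ← Set.Iic_union_Ioi (a := (0 : ℝ))]
    exact h.union hf
  · rw [← intervalIntegral.integral_Iic_add_Ioi h hf, integral_comp_neg_Ioi, neg_zero, add_comm]

lemma one_div_one_sub_exp_neg_le {y : ℝ} (hy : 0 < y) :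
    1 / (1 - Real.exp (-y)) ≤ (1 + y) / y := by
  have h := Real.add_one_le_exp y
  have h1 : Real.exp (-y) < 1 := Real.exp_lt_one_iff.2 (by linarith)
  rw [div_le_div_iff₀ (by linarith) hy, Real.exp_neg]
  have h2 : (Real.exp y)⁻¹ ≤ (1 + y)⁻¹ := by
    gcongr
    linarith
  have h3 : (1 + y) * (1 + y)⁻¹ = 1 := mul_inv_cancel₀ (by positivity)
  nlinarith

variable {σ α β : ℝ}

/-- After division by x, this geometric series exhibits v on the positive half-line as the sum of
the Lévy densities of the exponentials. The case b = 0 controls the drift. -/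
lemma hasSum_exp_neg (hσ : 0 < σ) (b : ℝ) {x : ℝ} (hx : 0 < x) :
    HasSum (fun j : ℕ => Real.exp (-((b + j) / σ * x)))
      (Real.exp (-(b * (x / σ))) / (1 - Real.exp (-x / σ))) := by
  have h : Real.exp (-x / σ) < 1 := Real.exp_lt_one_iff.2 (by rw [neg_div, neg_lt_zero]; positivity)
  refine ((hasSum_geometric_of_lt_one (Real.exp_pos _).le h).mul_left
    (Real.exp (-(b * (x / σ))))).congr_fun fun j => ?_
  rw [← Real.exp_nat_mul, ← Real.exp_add]
  congr 1
  ring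

lemma glLevyDensity_neg (x : ℝ) : glLevyDensity σ α β (-x) = glLevyDensity σ β α x := by
  simp only [glLevyDensity, abs_neg, Left.neg_pos_iff, Left.neg_neg_iff]
  rw [add_comm]

lemma glLevyDensity_of_pos {x : ℝ} (hx : 0 < x) : glLevyDensity σ α β x
    = Real.exp (-(β * (x / σ))) / (1 - Real.exp (-x / σ)) / x := by
  rw [glLevyDensity, if_pos hx, if_neg hx.le.not_gt, abs_of_pos hx, add_zero, div_div,
    mul_comm x]

lemma glLevyDensity_nonneg (hσ : 0 < σ) (x : ℝ) : 0 ≤ glLevyDensity σ α β x := by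
  have : Real.exp (-|x| / σ) ≤ 1 := by
    rw [Real.exp_le_one_iff, neg_div, neg_nonpos]
    positivity
  rw [glLevyDensity]
  have := sub_nonneg.2 this
  positivity

lemma measurable_glLevyDensity : Measurable (glLevyDensity σ α β) := by
  have h1 : Measurable fun x : ℝ => if 0 < x then β else 0 :=
    Measurable.ite measurableSet_Ioi measurable_const measurable_const
  have h2 : Measurable fun x : ℝ => if x < 0 then α else 0 :=
    Measurable.ite measurableSet_Iio measurable_const measurable_const
  unfold glLevyDensity
  fun_prop

/-- Near 0 the density behaves like σ/x², so x² v stays bounded there; at infinity it decays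
exponentially. -/
lemma integrableOn_sq_mul_glLevyDensity (hσ : 0 < σ) (hβ : 0 < β) :
    IntegrableOn (fun x => x ^ 2 * glLevyDensity σ α β x) (Set.Ioi 0) := by
  have hb : 0 < β / σ := by positivity
  have h1 : IntegrableOn (fun x : ℝ => σ * Real.exp (-(β / σ * x))
      + x * Real.exp (-(β / σ * x))) (Set.Ioi 0) := by
    refine ((integrableOn_exp_neg_mul hb).const_mul σ).add ?_
    simpa [IntegrableOn] using integrableOn_rpow_mul_exp_neg_mul_rpow (s := 1) (p := 1) (by norm_num) one_pos hb
  refine Integrable.mono' h1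
    (Measurable.aestronglyMeasurable (by have := @measurable_glLevyDensity σ α β; fun_prop)) ?_
  refine (ae_restrict_iff' measurableSet_Ioi).2 (ae_of_all _ fun x hx => ?_)
  have hx : 0 < x := hx
  rw [Real.norm_of_nonneg (mul_nonneg (sq_nonneg _) (glLevyDensity_nonneg hσ x)),
    glLevyDensity_of_pos hx]
  have h := one_div_one_sub_exp_neg_le (y := x / σ) (by positivity)
  rw [← neg_div] at h
  calc _ = x * Real.exp (-(β * (x / σ))) * (1 / (1 - Real.exp (-x / σ))) := by field_simp
    _ ≤ x * Real.exp (-(β * (x / σ))) * ((1 + x / σ) / (x / σ)) := by gcongr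
    _ = _ := by
      rw [show β * (x / σ) = β / σ * x by ring]
      field_simp

lemma integrable_sq_mul_glLevyDensity (hσ : 0 < σ) (hα : 0 < α) (hβ : 0 < β) :
    Integrable fun x => x ^ 2 * glLevyDensity σ α β x := by
  refine (integral_eq_integral_Ioi_add_integral_Ioi_neg
    (integrableOn_sq_mul_glLevyDensity hσ hβ) ?_).1
  simpa [glLevyDensity_neg] using integrableOn_sq_mul_glLevyDensity (α := β) hσ hα

lemma isLevyMeasure_glLevyMeasure (hσ : 0 < σ) (hα : 0 < α) (hβ : 0 < β) :
    IsLevyMeasure (glLevyMeasure σ α β) where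
  zero := withDensity_absolutelyContinuous _ _ Real.volume_singleton
  lintegral_lt_top := by
    rw [glLevyMeasure, lintegral_withDensity_eq_lintegral_mul _
      measurable_glLevyDensity.ennreal_ofReal (by fun_prop)]
    refine lt_of_le_of_lt (lintegral_mono fun x => ?_)
      (integrable_sq_mul_glLevyDensity hσ hα hβ).lintegral_lt_top
    rw [Pi.mul_apply, ← ENNReal.ofReal_mul (glLevyDensity_nonneg hσ x), mul_comm]
    exact ENNReal.ofReal_le_ofReal
      (mul_le_mul_of_nonneg_right (min_le_right _ _) (glLevyDensity_nonneg hσ x))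

lemma norm_levyKernel_mul_glLevyDensity_le (hσ : 0 < σ) (z x : ℝ) :
    ‖levyKernel z x * (glLevyDensity σ α β x : ℂ)‖
      ≤ (3 * z ^ 2 + 2) * (x ^ 2 * glLevyDensity σ α β x) := by
  rw [norm_mul, Complex.norm_real, Real.norm_of_nonneg (glLevyDensity_nonneg hσ x), ← mul_assoc]
  exact mul_le_mul_of_nonneg_right (norm_levyKernel_le z x) (glLevyDensity_nonneg hσ x)

lemma aestronglyMeasurable_levyKernel_mul_glLevyDensity (z : ℝ) (τ : Measure ℝ) :
    AEStronglyMeasurable (fun x => levyKernel z x * (glLevyDensity σ α β x : ℂ)) τ :=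
  ((measurable_levyKernel z).mul
    (Complex.measurable_ofReal.comp measurable_glLevyDensity)).aestronglyMeasurable

lemma integrableOn_levyKernel_mul_glLevyDensity (hσ : 0 < σ) (hβ : 0 < β) (z : ℝ) :
    IntegrableOn (fun x => levyKernel z x * (glLevyDensity σ α β x : ℂ)) (Set.Ioi 0) :=
  ((integrableOn_sq_mul_glLevyDensity hσ hβ).const_mul (3 * z ^ 2 + 2)).mono'
    (aestronglyMeasurable_levyKernel_mul_glLevyDensity _ _)
    (ae_of_all _ (norm_levyKernel_mul_glLevyDensity_le hσ z))

lemma levyExponent_glLevyMeasure (hσ : 0 < σ) (a z : ℝ) :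
    levyExponent a 0 (glLevyMeasure σ α β) z
      = Complex.I * z * a + ∫ x, levyKernel z x * (glLevyDensity σ α β x : ℂ) := by
  rw [levyExponent, glLevyMeasure, integral_withDensity_eq_integral_toReal_smul
    measurable_glLevyDensity.ennreal_ofReal (ae_of_all _ fun _ => ENNReal.ofReal_lt_top)]
  congr 1
  · simp
  · refine integral_congr_ae (ae_of_all _ fun x => ?_)
    simp only
    rw [ENNReal.toReal_ofReal (glLevyDensity_nonneg hσ x), Complex.real_smul, mul_comm]
    rfl

lemma continuousAt_levyExponent (hσ : 0 < σ) (hα : 0 < α) (hβ : 0 < β) (a : ℝ) :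
    ContinuousAt (levyExponent a 0 (glLevyMeasure σ α β)) 0 := by
  rw [funext (levyExponent_glLevyMeasure hσ a)]
  refine ContinuousAt.add (by fun_prop) (continuousAt_of_dominated
    -- The constant is 3z² + 2 at |z| = 1.
    (bound := fun x => 5 * (x ^ 2 * glLevyDensity σ α β x))
    (Eventually.of_forall fun z => aestronglyMeasurable_levyKernel_mul_glLevyDensity _ _) ?_
    ((integrable_sq_mul_glLevyDensity hσ hα hβ).const_mul 5) (ae_of_all _ fun x => ?_))
  · filter_upwards [Icc_mem_nhds (show (-1 : ℝ) < 0 by norm_num) one_pos] with z hz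
    refine ae_of_all _ fun x => (norm_levyKernel_mul_glLevyDensity_le hσ z x).trans ?_
    refine mul_le_mul_of_nonneg_right ?_ (mul_nonneg (sq_nonneg _) (glLevyDensity_nonneg hσ x))
    nlinarith [hz.1, hz.2]
  · exact ((continuous_levyKernel x).mul continuous_const).continuousAt

/-! ### Summation of the exponents -/

/-- The logarithms alone are of order 1/j; subtracting the truncation integrals makes the sum
converge. The partial sums of Lévy densities increase to v, so x² v, up to a constant, dominates. -/
lemma tendsto_sum_log_Ioi (hσ : 0 < σ) (hβ : 0 < β) (α z : ℝ) :
    Tendsto (fun N => ∑ j ∈ Finset.range N,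
      (-Complex.log (1 - Complex.I * z / ((β + j) / σ : ℝ))
        - Complex.I * z * (∫ x in (0 : ℝ)..1, Real.exp (-((β + j) / σ * x)) : ℝ))) atTop
      (𝓝 (∫ x in Set.Ioi 0, levyKernel z x * (glLevyDensity σ α β x : ℂ))) := by
  have hr : ∀ j : ℕ, 0 < (β + j) / σ := fun j => by positivity
  simp_rw [← fun j => (integrableOn_levyKernel_mul (hr j) z).2]
  simp_rw [← integral_finsetSum _ fun j _ => (integrableOn_levyKernel_mul (hr j) z).1]
  refine tendsto_integral_of_dominated_convergence
    (fun x => (3 * z ^ 2 + 2) * (x ^ 2 * glLevyDensity σ α β x))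
    (fun N => (integrable_finsetSum _ fun j _ =>
      (integrableOn_levyKernel_mul (hr j) z).1).aestronglyMeasurable)
    ((integrableOn_sq_mul_glLevyDensity hσ hβ).const_mul _) (fun N => ?_) ?_
  · refine (ae_restrict_iff' measurableSet_Ioi).2 (ae_of_all _ fun x hx => ?_)
    have hx : 0 < x := hx
    rw [← Finset.mul_sum, norm_mul, ← Complex.ofReal_sum, Complex.norm_real,
      Real.norm_of_nonneg (Finset.sum_nonneg fun j _ => by positivity), ← mul_assoc]
    refine mul_le_mul (norm_levyKernel_le z x) ?_
      (Finset.sum_nonneg fun j _ => by positivity) (by positivity)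
    rw [glLevyDensity_of_pos hx, ← Finset.sum_div]
    gcongr
    exact sum_le_hasSum _ (fun j _ => (Real.exp_pos _).le) (hasSum_exp_neg hσ β hx)
  · refine (ae_restrict_iff' measurableSet_Ioi).2 (ae_of_all _ fun x hx => ?_)
    have hx : 0 < x := hx
    rw [glLevyDensity_of_pos hx]
    exact ((Complex.hasSum_ofReal.2 ((hasSum_exp_neg hσ β hx).div_const x)).mul_left
      (levyKernel z x)).tendsto_sum_nat

lemma abs_exp_neg_sub_exp_neg_le {s t : ℝ} (hs : 0 ≤ s) (ht : 0 ≤ t) :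
    |Real.exp (-s) - Real.exp (-t)| ≤ |s - t| := by
  wlog h : s ≤ t generalizing s t
  · rw [abs_sub_comm, abs_sub_comm s]
    exact this ht hs (le_of_not_ge h)
  have h1 : Real.exp (-t) ≤ Real.exp (-s) := Real.exp_le_exp.2 (by linarith)
  rw [abs_of_nonneg (sub_nonneg.2 h1), abs_sub_comm, abs_of_nonneg (sub_nonneg.2 h)]
  have h2 : Real.exp (-t) = Real.exp (-s) * Real.exp (-(t - s)) := by
    rw [← Real.exp_add]
    ring_nf
  have h3 := Real.one_sub_le_exp_neg (t - s)
  have h4 : Real.exp (-s) ≤ 1 := Real.exp_le_one_iff.2 (by linarith)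
  have h5 := Real.exp_pos (-s)
  rw [h2]
  nlinarith

/-- Each of the two sums of integrals diverges like the harmonic series. In their difference the
factor exp(-βx/σ) - exp(-αx/σ) = O(x) cancels the 1/x singularity of the geometric series, which
permits dominated convergence. -/
lemma tendsto_sum_drift (hσ : 0 < σ) (hα : 0 < α) (hβ : 0 < β) (μ : ℝ) :
    Tendsto (fun N => ∑ j ∈ Finset.range N,
      ((∫ x in (0 : ℝ)..1, Real.exp (-((β + j) / σ * x)))
        - ∫ x in (0 : ℝ)..1, Real.exp (-((α + j) / σ * x)))) atTop
      (𝓝 (glDrift μ σ α β - μ)) := by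
  have h0 : glDrift μ σ α β - μ = ∫ x in (0 : ℝ)..1,
      (Real.exp (-(β * (x / σ))) / (1 - Real.exp (-x / σ))
        - Real.exp (-(α * (x / σ))) / (1 - Real.exp (-x / σ))) := by
    -- Rescaling by σ moves the drift integral from [0, 1/σ] to [0, 1], where the truncation lives.
    have := intervalIntegral.integral_comp_div (a := 0) (b := 1) (fun x =>
      (Real.exp (-(β * x)) - Real.exp (-(α * x))) / (1 - Real.exp (-x))) hσ.ne'
    rw [zero_div, one_div, smul_eq_mul] at this
    rw [glDrift, add_sub_cancel_right, ← this]
    simp_rw [sub_div, neg_div]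
  have hc : ∀ r : ℝ, IntervalIntegrable (fun x => Real.exp (-(r * x))) volume 0 1 := fun r =>
    Continuous.intervalIntegrable (by fun_prop) _ _
  simp_rw [h0, ← fun j : ℕ => intervalIntegral.integral_sub (hc ((β + j) / σ)) (hc ((α + j) / σ))]
  simp_rw [← intervalIntegral.integral_finsetSum fun (j : ℕ) _ =>
    (hc ((β + j) / σ)).sub (hc ((α + j) / σ))]
  refine intervalIntegral.tendsto_integral_filter_of_dominated_convergence
    (fun _ => |β - α| * (1 + 1 / σ)) (Eventually.of_forall fun N =>
      Continuous.aestronglyMeasurable (by fun_prop)) (Eventually.of_forall fun N =>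
      ae_of_all _ fun x hx => ?_) intervalIntegrable_const (ae_of_all _ fun x hx => ?_)
  · rw [Set.uIoc_of_le zero_le_one] at hx
    have hx0 : 0 < x := hx.1
    have h1 : ∑ j ∈ Finset.range N, (Real.exp (-((β + j) / σ * x)) - Real.exp (-((α + j) / σ * x)))
        = (Real.exp (-(β * (x / σ))) - Real.exp (-(α * (x / σ))))
          * ∑ j ∈ Finset.range N, Real.exp (-((0 + j) / σ * x)) := by
      rw [Finset.mul_sum]
      refine Finset.sum_congr rfl fun j _ => ?_
      rw [sub_mul, ← Real.exp_add, ← Real.exp_add]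
      ring_nf
    have h2 : ∑ j ∈ Finset.range N, Real.exp (-((0 + j) / σ * x)) ≤ (1 + x / σ) / (x / σ) := by
      refine (sum_le_hasSum _ (fun j _ => (Real.exp_pos _).le) (hasSum_exp_neg hσ 0 hx0)).trans ?_
      rw [zero_mul, neg_zero, Real.exp_zero, neg_div]
      exact one_div_one_sub_exp_neg_le (by positivity)
    rw [h1, norm_mul, Real.norm_eq_abs,
      Real.norm_of_nonneg (Finset.sum_nonneg fun j _ => (Real.exp_pos _).le)]
    calc _ ≤ |β * (x / σ) - α * (x / σ)| * ((1 + x / σ) / (x / σ)) :=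
          mul_le_mul (abs_exp_neg_sub_exp_neg_le (by positivity) (by positivity)) h2
            (Finset.sum_nonneg fun j _ => (Real.exp_pos _).le) (abs_nonneg _)
      _ = |β - α| * (1 + x / σ) := by
          rw [← sub_mul, abs_mul, abs_of_pos (div_pos hx0 hσ)]
          field_simp
      _ ≤ _ := by
          gcongr
          exact hx.2
  · rw [Set.uIoc_of_le zero_le_one] at hx
    exact ((hasSum_exp_neg hσ β hx.1).sub (hasSum_exp_neg hσ α hx.1)).tendsto_sum_nat

/-- The contribution of the `j`-th pole of `Γ` to the exponent of `GL(μ, σ, α, β)`. -/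
noncomputable def glTerm (σ α β : ℝ) (j : ℕ) (z : ℝ) : ℂ :=
  -Complex.log (1 - Complex.I * z / ((β + j) / σ : ℝ))
    + -Complex.log (1 - Complex.I * (-1 * z : ℝ) / ((α + j) / σ : ℝ))

/-- Reflecting the negative half-line exchanges α with β and z with -z. The two truncation terms
therefore enter with opposite signs, and `tendsto_sum_drift` applies to their difference. -/
lemma tendsto_sum_glTerm (hσ : 0 < σ) (hα : 0 < α) (hβ : 0 < β) (μ z : ℝ) :
    Tendsto (fun N => Complex.I * z * μ + ∑ j ∈ Finset.range N, glTerm σ α β j z) atTop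
      (𝓝 (levyExponent (glDrift μ σ α β) 0 (glLevyMeasure σ α β) z)) := by
  have h1 := tendsto_sum_log_Ioi hσ hβ α z
  have h2 := tendsto_sum_log_Ioi hσ hα β (-1 * z)
  have h3 := ((Complex.continuous_ofReal.tendsto _).comp
    (tendsto_sum_drift hσ hα hβ μ)).const_mul (Complex.I * z)
  have h4 := ((h1.add h2).add h3).const_add (Complex.I * z * μ)
  have h5 : levyExponent (glDrift μ σ α β) 0 (glLevyMeasure σ α β) z
      = Complex.I * z * μ + ((∫ x in Set.Ioi 0, levyKernel z x * (glLevyDensity σ α β x : ℂ))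
        + (∫ x in Set.Ioi 0, levyKernel (-1 * z) x * (glLevyDensity σ β α x : ℂ))
        + Complex.I * z * (glDrift μ σ α β - μ : ℝ)) := by
    rw [levyExponent_glLevyMeasure hσ, (integral_eq_integral_Ioi_add_integral_Ioi_neg
      (integrableOn_levyKernel_mul_glLevyDensity hσ hβ z) ?_).2]
    · simp_rw [levyKernel_neg, glLevyDensity_neg]
      rw [neg_one_mul]
      push_cast
      ring
    · simp_rw [levyKernel_neg, glLevyDensity_neg]
      exact integrableOn_levyKernel_mul_glLevyDensity hσ hα _
  rw [h5]
  refine h4.congr fun N => ?_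
  simp only [Function.comp_apply, Complex.ofReal_sum, Finset.mul_sum]
  rw [← Finset.sum_add_distrib, ← Finset.sum_add_distrib]
  congr 1
  refine Finset.sum_congr rfl fun j _ => ?_
  rw [glTerm]
  push_cast
  ring

/-! ### The characteristic function as a quotient of Gamma values -/

lemma logisticCDF_mem_Ioo (μ σ x : ℝ) : logisticCDF μ σ x ∈ Set.Ioo 0 1 := by
  have := Real.exp_pos (-((x - μ) / σ))
  rw [logisticCDF]
  exact ⟨by positivity, by rw [div_lt_one (by positivity)]; linarith⟩

lemma log_logisticCDF_sub_log (μ σ x : ℝ) :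
    Real.log (logisticCDF μ σ x) - Real.log (1 - logisticCDF μ σ x) = (x - μ) / σ := by
  have h := logisticCDF_mem_Ioo μ σ x
  rw [← Real.log_div h.1.ne' (sub_pos.2 h.2).ne']
  have : logisticCDF μ σ x / (1 - logisticCDF μ σ x) = Real.exp ((x - μ) / σ) := by
    have h1 := Real.exp_pos ((x - μ) / σ)
    rw [div_eq_iff (sub_pos.2 h.2).ne', logisticCDF, Real.exp_neg]
    field_simp
    ring
  rw [this, Real.log_exp]

lemma hasDerivAt_logisticCDF (μ σ x : ℝ) :
    HasDerivAt (logisticCDF μ σ) (logisticPDF μ σ x) x := by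
  have h0 : (1 + Real.exp (-((x - μ) / σ))) ≠ 0 := by positivity
  have h1 : HasDerivAt (fun x => -((x - μ) / σ)) (-(1 / σ)) x :=
    (((hasDerivAt_id x).sub_const μ).div_const σ).neg
  have h2 := (h1.exp.const_add 1).inv h0
  have h3 : logisticCDF μ σ = fun x => (1 + Real.exp (-((x - μ) / σ)))⁻¹ := by
    ext
    rw [logisticCDF, one_div]
  rw [h3]
  refine h2.congr_deriv ?_
  rw [logisticPDF]
  -- For σ = 0 both sides are 0, by the convention for division by zero.
  by_cases hσ : σ = 0
  · simp [hσ]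
  · field_simp

lemma logisticCDF_injective (μ : ℝ) (hσ : 0 < σ) : Function.Injective (logisticCDF μ σ) := by
  intro x y h
  have := log_logisticCDF_sub_log μ σ x
  rw [h, log_logisticCDF_sub_log, div_left_inj' hσ.ne', sub_left_inj] at this
  exact this.symm

lemma range_logisticCDF (μ : ℝ) (hσ : 0 < σ) : Set.range (logisticCDF μ σ) = Set.Ioo 0 1 := by
  refine Set.Subset.antisymm (Set.range_subset_iff.2 (logisticCDF_mem_Ioo μ σ)) fun u hu => ?_
  have h1 : 0 < 1 - u := sub_pos.2 hu.2
  have h2 : 0 < u := hu.1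
  refine ⟨μ + σ * Real.log (u / (1 - u)), ?_⟩
  rw [logisticCDF, add_sub_cancel_left, mul_div_cancel_left₀ _ hσ.ne', Real.exp_neg,
    Real.exp_log (by positivity)]
  field_simp
  ring

lemma logisticPDF_nonneg (μ : ℝ) (hσ : 0 < σ) (x : ℝ) : 0 ≤ logisticPDF μ σ x := by
  rw [logisticPDF]
  positivity

lemma glPDF_nonneg (μ : ℝ) (hσ : 0 < σ) (hα : 0 < α) (hβ : 0 < β) (x : ℝ) :
    0 ≤ glPDF μ σ α β x := by
  have h := logisticCDF_mem_Ioo μ σ x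
  have h1 := sub_pos.2 h.2
  have h2 := h.1
  have h3 := beta_pos hα hβ
  have h4 := logisticPDF_nonneg μ hσ x
  rw [glPDF]
  positivity

lemma measurable_glPDF (μ σ α β : ℝ) : Measurable (glPDF μ σ α β) := by
  unfold glPDF logisticPDF logisticCDF
  fun_prop

/-- Substitute u = F(x). Since (x - μ)/σ = log(u/(1 - u)), the exponential becomes (u/(1 - u))^(izσ)
and shifts the two beta parameters. -/
lemma integral_logistic_eq_betaIntegral (μ : ℝ) (hσ : 0 < σ) (α β z : ℝ) :
    ∫ x, (logisticPDF μ σ x * logisticCDF μ σ x ^ (α - 1) * (1 - logisticCDF μ σ x) ^ (β - 1) : ℝ)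
      * Complex.exp (Complex.I * z * (x - μ))
      = Complex.betaIntegral (α + Complex.I * z * σ) (β - Complex.I * z * σ) := by
  rw [Complex.betaIntegral, intervalIntegral.integral_of_le zero_le_one,
    integral_Ioc_eq_integral_Ioo, ← range_logisticCDF μ hσ, ← Set.image_univ,
    integral_image_eq_integral_abs_deriv_smul MeasurableSet.univ
      (fun x _ => (hasDerivAt_logisticCDF μ σ x).hasDerivWithinAt)
      (logisticCDF_injective μ hσ).injOn, setIntegral_univ]
  refine integral_congr_ae (ae_of_all _ fun x => ?_)
  have h := logisticCDF_mem_Ioo μ σ x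
  have h1 := sub_pos.2 h.2
  have h2 : (logisticCDF μ σ x : ℂ) ≠ 0 := by exact_mod_cast h.1.ne'
  have h3 : (1 - logisticCDF μ σ x : ℂ) ≠ 0 := by exact_mod_cast h1.ne'
  have h4 : ((Real.log (logisticCDF μ σ x) : ℂ) - Real.log (1 - logisticCDF μ σ x)) * σ
      = x - μ := by
    have := log_logisticCDF_sub_log μ σ x
    rw [eq_div_iff hσ.ne'] at this
    exact_mod_cast this
  have h5 : Complex.log (1 - logisticCDF μ σ x) = Real.log (1 - logisticCDF μ σ x) := by
    rw [Complex.ofReal_log h1.le]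
    push_cast
    rfl
  simp only
  rw [abs_of_nonneg (logisticPDF_nonneg μ hσ x), Complex.real_smul, Complex.ofReal_mul,
    Complex.ofReal_mul, mul_assoc, mul_assoc]
  congr 1
  rw [Real.rpow_def_of_pos h.1, Real.rpow_def_of_pos h1, Complex.cpow_def_of_ne_zero h2,
    Complex.cpow_def_of_ne_zero h3, ← Complex.ofReal_log h.1.le, h5, Complex.ofReal_exp, Complex.ofReal_exp,
    ← Complex.exp_add, ← Complex.exp_add, ← Complex.exp_add, ← h4]
  congr 1
  push_cast
  ring

lemma charFun_glMeasure (μ : ℝ) (hσ : 0 < σ) (hα : 0 < α) (hβ : 0 < β) (z : ℝ) :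
    charFun (glMeasure μ σ α β) z = Complex.exp (Complex.I * z * μ)
      * (Complex.Gamma (α + Complex.I * z * σ) * Complex.Gamma (β - Complex.I * z * σ)
        / (Complex.Gamma α * Complex.Gamma β)) := by
  have h1 : ∀ x : ℝ, (ENNReal.ofReal (glPDF μ σ α β x)).toReal • Complex.exp (z * x * Complex.I)
      = Complex.exp (Complex.I * z * μ) * (1 / beta α β : ℝ) *
        ((logisticPDF μ σ x * logisticCDF μ σ x ^ (α - 1)
          * (1 - logisticCDF μ σ x) ^ (β - 1) : ℝ)
          * Complex.exp (Complex.I * z * (x - μ))) := by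
    intro x
    have : z * x * Complex.I = Complex.I * z * μ + Complex.I * z * (x - μ) := by ring
    rw [ENNReal.toReal_ofReal (glPDF_nonneg μ hσ hα hβ x), Complex.real_smul, this,
      Complex.exp_add, glPDF]
    push_cast
    ring
  rw [charFun_apply_real, glMeasure, integral_withDensity_eq_integral_toReal_smul
    (measurable_glPDF μ σ α β).ennreal_ofReal (ae_of_all _ fun _ => ENNReal.ofReal_lt_top)]
  simp_rw [h1]
  rw [integral_const_mul, integral_logistic_eq_betaIntegral μ hσ,
    Complex.betaIntegral_eq_Gamma_mul_div _ _ (by simpa using hα) (by simpa using hβ), beta]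
  have h2 : (α + Complex.I * z * σ + (β - Complex.I * z * σ) : ℂ) = (α + β : ℝ) := by
    push_cast
    ring
  have h3 := (Real.Gamma_pos_of_pos hα).ne'
  have h4 := (Real.Gamma_pos_of_pos hβ).ne'
  have h5 : (Real.Gamma (α + β) : ℂ) ≠ 0 := by
    exact_mod_cast (Real.Gamma_pos_of_pos (add_pos hα hβ)).ne'
  rw [h2, Complex.Gamma_ofReal, Complex.Gamma_ofReal, Complex.Gamma_ofReal]
  push_cast
  field_simp

/-- The total mass is φ(0), where the Gamma quotient is 1. -/
lemma isProbabilityMeasure_glMeasure (μ : ℝ) (hσ : 0 < σ) (hα : 0 < α) (hβ : 0 < β) :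
    IsProbabilityMeasure (glMeasure μ σ α β) := by
  have h := charFun_glMeasure μ hσ hα hβ 0
  have h3 : (Real.Gamma α : ℂ) ≠ 0 := by exact_mod_cast (Real.Gamma_pos_of_pos hα).ne'
  have h4 : (Real.Gamma β : ℂ) ≠ 0 := by exact_mod_cast (Real.Gamma_pos_of_pos hβ).ne'
  rw [charFun_zero] at h
  simp only [Complex.ofReal_zero, mul_zero, zero_mul, add_zero, sub_zero, Complex.exp_zero,
    one_mul, Complex.Gamma_ofReal] at h
  rw [div_self (mul_ne_zero h3 h4), Complex.ofReal_eq_one] at h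
  refine ⟨?_⟩
  rwa [Measure.real, ENNReal.toReal_eq_one_iff] at h

/-! ### Euler's product and the Lévy triplet -/

lemma add_I_mul_add_natCast_ne_zero {b : ℝ} (hb : 0 < b) (w : ℝ) (j : ℕ) :
    (b + Complex.I * w + j : ℂ) ≠ 0 := fun h => by
  have := congrArg Complex.re h
  simp at this
  have : (0 : ℝ) ≤ j := j.cast_nonneg
  linarith

lemma exp_glTerm (hσ : 0 < σ) (hα : 0 < α) (hβ : 0 < β) (j : ℕ) (z : ℝ) :
    Complex.exp (glTerm σ α β j z) = (β + j) / (β - Complex.I * z * σ + j)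
      * ((α + j) / (α + Complex.I * z * σ + j)) := by
  have key : ∀ b : ℝ, 0 < b → ∀ z : ℝ,
      Complex.exp (-Complex.log (1 - Complex.I * z / ((b + j) / σ : ℝ)))
        = (b + j) / (b - Complex.I * z * σ + j) := by
    intro b hb z
    have h1 : (0 : ℝ) < (b + j) / σ := by positivity
    have h2 : (b + j : ℂ) ≠ 0 := by
      have := add_I_mul_add_natCast_ne_zero hb 0 j
      simpa using this
    have h3 : (σ : ℂ) ≠ 0 := by exact_mod_cast hσ.ne'
    rw [Complex.exp_neg, Complex.exp_log (Complex.slitPlane_ne_zero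
      (one_sub_div_mem_slitPlane h1 (by simpa using h1)))]
    have h4 : 1 - Complex.I * z / ((b + j) / σ : ℝ)
        = (b - Complex.I * z * σ + j) / (b + j) := by
      push_cast
      field_simp
      ring
    rw [h4, inv_div]
  rw [glTerm, Complex.exp_add, key β hβ, key α hα]
  push_cast
  ring

/-- In the quotient of Euler sequences the factorials cancel, and so do the powers of n, because (α
+ izσ) + (β - izσ) = α + β. What remains is the partial product of the exponential factors. -/
lemma tendsto_exp_sum_glTerm (μ : ℝ) (hσ : 0 < σ) (hα : 0 < α) (hβ : 0 < β) (z : ℝ) :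
    Tendsto (fun N => Complex.exp (Complex.I * z * μ + ∑ j ∈ Finset.range N, glTerm σ α β j z))
      atTop (𝓝 (charFun (glMeasure μ σ α β) z)) := by
  have h3 : (Real.Gamma α : ℂ) ≠ 0 := by exact_mod_cast (Real.Gamma_pos_of_pos hα).ne'
  have h4 : (Real.Gamma β : ℂ) ≠ 0 := by exact_mod_cast (Real.Gamma_pos_of_pos hβ).ne'
  -- `Complex.GammaSeq s n` has the n + 1 factors s, ..., s + n in its denominator, hence the shift.
  rw [charFun_glMeasure μ hσ hα hβ, ← tendsto_add_atTop_iff_nat 1]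
  have ht := ((((Complex.GammaSeq_tendsto_Gamma (α + Complex.I * z * σ)).mul
    (Complex.GammaSeq_tendsto_Gamma (β - Complex.I * z * σ))).div
    ((Complex.GammaSeq_tendsto_Gamma α).mul (Complex.GammaSeq_tendsto_Gamma β))
    (by rw [Complex.Gamma_ofReal, Complex.Gamma_ofReal]; exact mul_ne_zero h3 h4)).const_mul
    (Complex.exp (Complex.I * z * μ)))
  refine ht.congr' ?_
  filter_upwards [eventually_ne_atTop 0] with n hn
  have hn' : (n : ℂ) ≠ 0 := by exact_mod_cast hn
  rw [Complex.exp_add, Complex.exp_sum, Finset.prod_congr rfl fun j _ => exp_glTerm hσ hα hβ j z,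
    Finset.prod_mul_distrib, Finset.prod_div_distrib, Finset.prod_div_distrib]
  congr 1
  have c1 : (n : ℂ) ^ (α + Complex.I * z * σ) * (n : ℂ) ^ (β - Complex.I * z * σ)
      = (n : ℂ) ^ (α : ℂ) * (n : ℂ) ^ (β : ℂ) := by
    rw [← Complex.cpow_add _ _ hn', ← Complex.cpow_add _ _ hn']
    congr 1
    ring
  have c2 : (n : ℂ) ^ (α : ℂ) ≠ 0 := by simp [Complex.cpow_eq_zero_iff, hn']
  have c3 : (n : ℂ) ^ (β : ℂ) ≠ 0 := by simp [Complex.cpow_eq_zero_iff, hn']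
  have c4 : (n.factorial : ℂ) ≠ 0 := by exact_mod_cast n.factorial_ne_zero
  simp only [Complex.GammaSeq, Pi.div_apply]
  rw [div_mul_div_comm, div_mul_div_comm, mul_mul_mul_comm, c1,
    mul_mul_mul_comm, div_div_div_comm, div_self (by simp [c2, c3, c4]), one_div, inv_div,
    mul_div_mul_comm, mul_comm]

/-- The same partial products have both sides as limits. Comparing after exponentiation avoids any
choice of logarithm for Γ. -/
lemma charFun_glMeasure_eq_exp_levyExponent (μ : ℝ) (hσ : 0 < σ) (hα : 0 < α) (hβ : 0 < β)
    (z : ℝ) : charFun (glMeasure μ σ α β) z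
      = Complex.exp (levyExponent (glDrift μ σ α β) 0 (glLevyMeasure σ α β) z) :=
  tendsto_nhds_unique (tendsto_exp_sum_glTerm μ hσ hα hβ z)
    ((Complex.continuous_exp.tendsto _).comp (tendsto_sum_glTerm hσ hα hβ μ z))

/-! ### Infinite divisibility and self-decomposability -/

/-- Dividing the exponent by n replaces each exponential variable by a gamma variable of shape 1/n,
and μ by μ/n. -/
lemma isCharExponent_levyExponent_div (μ : ℝ) (hσ : 0 < σ) (hα : 0 < α) (hβ : 0 < β) {n : ℕ}
    (hn : 0 < n) : IsCharExponent fun z =>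
      1 / n * levyExponent (glDrift μ σ α β) 0 (glLevyMeasure σ α β) z := by
  refine isCharExponent_of_tendsto (fun N => ?_)
    (fun z => (tendsto_sum_glTerm hσ hα hβ μ z).const_mul _)
    ((continuousAt_levyExponent hσ hα hβ _).const_mul _)
  have hn' : (0 : ℝ) < 1 / n := by positivity
  refine ((isCharExponent_linear (1 / n * μ)).add (isCharExponent_sum (fun j =>
    (isCharExponent_gamma hn' (show 0 < (β + j) / σ by positivity)).add
    ((isCharExponent_gamma hn' (show 0 < (α + j) / σ by positivity)).comp_mul (-1))) N)).congr
    fun z => ?_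
  rw [mul_add, Finset.mul_sum]
  simp only [glTerm]
  push_cast
  congr 2
  · ring
  · exact Finset.sum_congr rfl fun j _ => by ring

/-- Self-decomposability holds summand by summand; the location contributes the point mass at (1 -
c)μ. -/
lemma isCharExponent_levyExponent_sub (μ : ℝ) (hσ : 0 < σ) (hα : 0 < α) (hβ : 0 < β) {c : ℝ}
    (hc : 0 < c) (hc' : c < 1) : IsCharExponent fun z =>
      levyExponent (glDrift μ σ α β) 0 (glLevyMeasure σ α β) z
        - levyExponent (glDrift μ σ α β) 0 (glLevyMeasure σ α β) (c * z) := by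
  have hcont := continuousAt_levyExponent hσ hα hβ (glDrift μ σ α β)
  refine isCharExponent_of_tendsto (fun N => ?_)
    (fun z => (tendsto_sum_glTerm hσ hα hβ μ z).sub (tendsto_sum_glTerm hσ hα hβ μ (c * z)))
    (hcont.sub (hcont.comp_of_eq (f := fun z : ℝ => c * z) (by fun_prop) (mul_zero c)))
  refine ((isCharExponent_linear ((1 - c) * μ)).add (isCharExponent_sum (fun j =>
    (isCharExponent_exponential_sub (show 0 < (β + j) / σ by positivity) hc hc').add
    ((isCharExponent_exponential_sub (show 0 < (α + j) / σ by positivity) hc hc').comp_mul (-1)))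
    N)).congr fun z => ?_
  rw [add_sub_add_comm, ← Finset.sum_sub_distrib]
  simp only [glTerm]
  congr 2
  · push_cast
    ring
  · refine Finset.sum_congr rfl fun j _ => ?_
    rw [mul_left_comm (-1) c z]
    ring

lemma charFun_convPow (ρ : Measure ℝ) [IsProbabilityMeasure ρ] (n : ℕ) :
    IsProbabilityMeasure (convPow ρ n) ∧ ∀ z, charFun (convPow ρ n) z = charFun ρ z ^ n := by
  induction n with
  | zero => exact ⟨by rw [convPow]; infer_instance, fun z => by simp [convPow, charFun_dirac]⟩
  | succ n ih =>
    have := ih.1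
    exact ⟨by rw [convPow]; infer_instance, fun z => by rw [convPow, charFun_conv, ih.2, pow_succ]⟩

lemma isInfinitelyDivisible_glMeasure (μ : ℝ) (hσ : 0 < σ) (hα : 0 < α) (hβ : 0 < β) :
    IsInfinitelyDivisible (glMeasure μ σ α β) := by
  intro n hn
  obtain ⟨ρ, hρ, e⟩ := isCharExponent_levyExponent_div μ hσ hα hβ hn
  have := isProbabilityMeasure_glMeasure μ hσ hα hβ
  have h := charFun_convPow ρ n
  have := h.1
  refine ⟨ρ, hρ, Measure.ext_of_charFun (funext fun z => ?_)⟩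
  have hn' : (n : ℂ) ≠ 0 := by exact_mod_cast (show n ≠ 0 by omega)
  rw [h.2, e, ← Complex.exp_nat_mul, ← mul_assoc, mul_one_div_cancel hn', one_mul,
    charFun_glMeasure_eq_exp_levyExponent μ hσ hα hβ]

lemma hasLevyTriplet_glMeasure (μ : ℝ) (hσ : 0 < σ) (hα : 0 < α) (hβ : 0 < β) :
    HasLevyTriplet (glMeasure μ σ α β) (glDrift μ σ α β) 0 (glLevyMeasure σ α β) where
  isProbabilityMeasure := isProbabilityMeasure_glMeasure μ hσ hα hβ
  gaussian_nonneg := le_rfl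
  isLevyMeasure := isLevyMeasure_glLevyMeasure hσ hα hβ
  charFun_eq := charFun_glMeasure_eq_exp_levyExponent μ hσ hα hβ

lemma isSelfDecomposable_glMeasure (μ : ℝ) (hσ : 0 < σ) (hα : 0 < α) (hβ : 0 < β) :
    IsSelfDecomposable (glMeasure μ σ α β) where
  isProbabilityMeasure := isProbabilityMeasure_glMeasure μ hσ hα hβ
  exists_conv c hc hc' := by
    obtain ⟨ρ, hρ, e⟩ := isCharExponent_levyExponent_sub μ hσ hα hβ hc hc'
    have := isProbabilityMeasure_glMeasure μ hσ hα hβ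
    have : IsProbabilityMeasure ((glMeasure μ σ α β).map fun x => c * x) :=
      Measure.isProbabilityMeasure_map (by fun_prop)
    refine ⟨ρ, hρ, Measure.ext_of_charFun (funext fun z => ?_)⟩
    rw [charFun_conv, charFun_map_mul, e, charFun_glMeasure_eq_exp_levyExponent μ hσ hα hβ,
      charFun_glMeasure_eq_exp_levyExponent μ hσ hα hβ, ← Complex.exp_add, add_sub_cancel]

end GenLogistic

theorem lemma1 (μ σ α β : ℝ) (hσ : 0 < σ) (hα : 0 < α) (hβ : 0 < β) :
    GenLogistic.IsInfinitelyDivisible (GenLogistic.glMeasure μ σ α β) ∧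
    GenLogistic.HasLevyTriplet (GenLogistic.glMeasure μ σ α β)
      (GenLogistic.glDrift μ σ α β) 0 (GenLogistic.glLevyMeasure σ α β) ∧
    GenLogistic.IsSelfDecomposable (GenLogistic.glMeasure μ σ α β) :=
  ⟨GenLogistic.isInfinitelyDivisible_glMeasure μ hσ hα hβ,
    GenLogistic.hasLevyTriplet_glMeasure μ hσ hα hβ,
    GenLogistic.isSelfDecomposable_glMeasure μ hσ hα hβ⟩
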